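/- Let $G=\prod_{i=1}^{d}\alpha_i\mathbf Z\times\prod_{j=1}^{e}\mathbf Z/n_j\mathbf Z$ with $d,e\ge 0$, real $\alpha_i>0$ and integers $n_j\ge 1$. For $g=(x_1,\dots,x_d,m_1,\dots,m_e)\in G$ put $|g|=\max\{|x_1|,\dots,|x_d|,\delta(m_1),\dots,\delta(m_e)\}$ (with value $0$ if $d=e=0$), where $\delta(m)=0$ if $m=0$ and $\delta(m)=1$ otherwise. For $j\in G$ and an integer $N\ge 0$ let $S_N(j)=\{k\in G:|k-j|\le N/2\}$. Let $I$ be a countable set and $a\colon I\to G$ a map, with upper density $$D^+(I,a)=\limsup_{N\to\infty}\,\sup_{j\in G}\frac{|a^{-1}(S_N(j))|}{|S_N(j)|}\in[0,\infty].$$ Let $H$ be a separable complex Hilbert space and let $\mathcal F=\{f_i\}_{i\in I}$ be a frame for $H$, i.e. there are $A,B>0$ with $A\|f\|^2\le\sum_{i\in I}|\langle f,f_i\rangle|^2\le B\|f\|^2$ for all $f\in H$. Let $Sf=\sum_{i\in I}\langle f,f_i\rangle f_i$ be its frame operator (a bounded, positive, invertible operator on $H$), $\tilde{\mathcal F}=\{\tilde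 f_i\}_{i\in I}$ with $\tilde f_i=S^{-1}f_i$ its canonical dual frame, and $S^{-1/2}(\mathcal F)=\{S^{-1/2}f_i\}_{i\in I}$ its canonical Parseval frame. A sequence $\{g_i\}_{i\in I}$ in $H$ is called $\ell^1$-self-localized (with respect to $a$) if there is $r\in\ell^1(G)$ such that $|\langle g_i,g_j\rangle|\le r_{a(i)-a(j)}$ for all $i,j\in I$. The frame $\mathcal F$ is called $\ell^1$-localized with respect to its canonical dual frame (and $a$) if there is $r\in\ell^1(G)$ such that $|\langle f_i,\tilde f_j\rangle|\le r_{a(i)-a(j)}$ for all $i,j\in I$. **Theorem.** Suppose that $D^+(I,a)<\infty$ and that $(\mathcal F,a)$ is $\ell^1$-self-localized. Then (a) $(\mathcal F,a)$ is $\ell^1$-localized with respect to its canonical dual frame $\tilde{\mathcal F}$; (b) $(\tilde{\mathcal F},a)$ is $\ell^1$-self-localized; and (c) $(S^{-1/2}(\mathcal F),a)$ is $\ell^1$-self-localized. -/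

import Mathlib

open scoped ENNReal NNReal

noncomputable section

namespace LocalizedFrames

/-! ### The reference group and density -/

/-- The reference group `∏ i, α i ℤ × ∏ j, ℤ / n j`, where `α i ℤ` is the subgroup of `ℝ`
generated by `α i`. -/
abbrev RefGroup {d e : ℕ} (α : Fin d → ℝ) (n : Fin e → ℕ) : Type :=
  (∀ i, AddSubgroup.zmultiples (α i)) × (∀ j, ZMod (n j))

section Density

variable {d e : ℕ} {α : Fin d → ℝ} {n : Fin e → ℕ}

/-- The size `|g|` of a group element: the largest of the absolute values of its real
coordinates and of the numbers `δ (m j)`, where `δ m = 0` if `m = 0` and `δ m = 1` otherwise. -/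
def size (g : RefGroup α n) : ℝ≥0 :=
  max (Finset.univ.sup fun i => ‖(g.1 i : ℝ)‖₊)
    (Finset.univ.sup fun j => if g.2 j = 0 then 0 else 1)

/-- The box `S_N(j) = {k : |k - j| ≤ N / 2}`. -/
def box (N : ℕ) (j : RefGroup α n) : Set (RefGroup α n) :=
  {k | (size (k - j) : ℝ) ≤ (N : ℝ) / 2}

/-- The upper density `D⁺(I, a) = limsup_N sup_j |a⁻¹(S_N(j))| / |S_N(j)|`, in `[0, ∞]`.
Points of `I` are counted with multiplicity. -/
def upperDensity {I : Type*} (a : I → RefGroup α n) : ℝ≥0∞ :=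
  Filter.limsup
    (fun N : ℕ => ⨆ j : RefGroup α n,
      ((a ⁻¹' box N j).encard : ℝ≥0∞) / ((box N j).encard : ℝ≥0∞))
    Filter.atTop

/-- Boxes are finite, so that the quotients in the density are genuine. -/
theorem box_finite (hn : ∀ j, 0 < n j) (N : ℕ) (j : RefGroup α n) : (box N j).Finite := by
  have : ∀ j, NeZero (n j) := fun j => ⟨(hn j).ne'⟩
  have key : ∀ (c x : ℝ),
      {y : AddSubgroup.zmultiples c | |(y : ℝ) - x| ≤ (N : ℝ) / 2}.Finite := by
    intro c x
    have hd : DiscreteTopology (AddSubgroup.zmultiples c : Set ℝ) :=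
      inferInstanceAs (DiscreteTopology (AddSubgroup.zmultiples c))
    have h := Metric.finite_isBounded_inter_isClosed
      ⟨hd⟩
      (Metric.isBounded_closedBall (x := x) (r := (N : ℝ) / 2))
      (AddSubgroup.isClosed_of_discrete (H := AddSubgroup.zmultiples c))
    refine Set.Finite.of_finite_image (f := Subtype.val) (h.subset ?_)
      Subtype.val_injective.injOn
    rintro _ ⟨y, hy, rfl⟩
    exact ⟨by simpa [Real.dist_eq] using hy, y.2⟩
  refine ((Set.Finite.pi' fun i => key (α i) (j.1 i)).prod
    (Set.toFinite (Set.univ : Set (∀ j, ZMod (n j))))).subset ?_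
  intro k hk
  refine ⟨fun i => ?_, Set.mem_univ _⟩
  have h1 : ‖((k - j).1 i : ℝ)‖₊ ≤ size (k - j) :=
    le_max_of_le_left
      (Finset.le_sup (f := fun i => ‖((k - j).1 i : ℝ)‖₊) (Finset.mem_univ i))
  have h2 : ‖((k - j).1 i : ℝ)‖ ≤ size (k - j) := by exact_mod_cast h1
  exact (by simpa using h2 : |(k.1 i : ℝ) - j.1 i| ≤ _).trans hk

end Density

/-! ### Frames -/

section Frames

variable {H : Type*} [NormedAddCommGroup H] [InnerProductSpace ℂ H] {I : Type*}

/-- `f` is a frame for `H`: there are `A, B > 0` with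
`A ‖x‖² ≤ ∑ i, |⟨x, f i⟩|² ≤ B ‖x‖²` for all `x`, the sum being convergent. -/
def IsFrame (f : I → H) : Prop :=
  ∃ A B : ℝ, 0 < A ∧ 0 < B ∧ ∀ x : H,
    Summable (fun i => ‖inner ℂ (f i) x‖ ^ 2) ∧
    A * ‖x‖ ^ 2 ≤ ∑' i, ‖inner ℂ (f i) x‖ ^ 2 ∧
    ∑' i, ‖inner ℂ (f i) x‖ ^ 2 ≤ B * ‖x‖ ^ 2

theorem IsFrame.memℓp {f : I → H} (hf : IsFrame f) (x : H) :
    Memℓp (fun i => inner ℂ (f i) x) 2 := by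
  obtain ⟨A, B, -, -, h⟩ := hf
  refine memℓp_gen ?_
  simpa using (h x).1

theorem IsFrame.norm_sq {f : I → H} (hf : IsFrame f) (x : H) :
    ‖(⟨fun i => inner ℂ (f i) x, hf.memℓp x⟩ : lp (fun _ : I => ℂ) 2)‖ ^ 2
      = ∑' i, ‖inner ℂ (f i) x‖ ^ 2 := by
  have h := lp.norm_rpow_eq_tsum (p := 2) (by norm_num)
    (⟨fun i => inner ℂ (f i) x, hf.memℓp x⟩ : lp (fun _ : I => ℂ) 2)
  simpa using h

/-- The analysis operator `T x = (⟨x, f i⟩)_i` of a frame, from `H` to `ℓ²(I)`.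
(Mathlib's inner product is linear in the second variable.) -/
def analysis (f : I → H) (hf : IsFrame f) : H →L[ℂ] lp (fun _ : I => ℂ) 2 :=
  LinearMap.mkContinuousOfExistsBound
    { toFun := fun x => ⟨fun i => inner ℂ (f i) x, hf.memℓp x⟩
      map_add' := fun x y => by
        ext i
        exact inner_add_right (f i) x y
      map_smul' := fun c x => by
        ext i
        exact inner_smul_right (f i) x c }
    (by
      have hf' := hf
      obtain ⟨A, B, -, hB, h⟩ := hf'
      refine ⟨√B, fun x => ?_⟩
      refine abs_le_of_sq_le_sq' ?_ (by positivity) |>.2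
      rw [mul_pow, Real.sq_sqrt hB.le]
      exact (hf.norm_sq x).trans_le (h x).2.2)

variable [CompleteSpace H]

/-- The frame operator `S = T* T`, that is, `S x = ∑ i, ⟨x, f i⟩ f i`. -/
def frameOperator (f : I → H) (hf : IsFrame f) : H →L[ℂ] H :=
  (ContinuousLinearMap.adjoint (analysis f hf)).comp (analysis f hf)

/-- The frame operator is invertible, so that `S⁻¹` and `S^{-1/2}` below are genuine. -/
theorem isUnit_frameOperator (f : I → H) (hf : IsFrame f) : IsUnit (frameOperator f hf) := by
  have hf' := hf
  obtain ⟨A, B, hA, -, h⟩ := hf'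
  refine ContinuousLinearMap.isUnit_of_forall_le_norm_inner_map _ (c := ⟨A, hA.le⟩) hA ?_
  intro x
  have h1 : inner ℂ (frameOperator f hf x) x = ((‖analysis f hf x‖ ^ 2 : ℝ) : ℂ) := by
    rw [frameOperator, ContinuousLinearMap.comp_apply, ContinuousLinearMap.adjoint_inner_left,
      inner_self_eq_norm_sq_to_K]
    norm_cast
  rw [h1, Complex.norm_real, Real.norm_of_nonneg (by positivity)]
  have h2 : ‖analysis f hf x‖ ^ 2 = ∑' i, ‖inner ℂ (f i) x‖ ^ 2 := hf.norm_sq x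
  rw [h2]
  calc ‖x‖ ^ 2 * A = A * ‖x‖ ^ 2 := mul_comm _ _
    _ ≤ _ := (h x).2.1

/-- The canonical dual frame `(S⁻¹ f i)_i`. -/
def canonicalDual (f : I → H) (hf : IsFrame f) : I → H :=
  fun i => Ring.inverse (frameOperator f hf) (f i)

/-- The canonical Parseval frame `(S^{-1/2} f i)_i`; the power is the one given by the
continuous functional calculus. -/
def canonicalParseval (f : I → H) (hf : IsFrame f) : I → H :=
  fun i => (frameOperator f hf ^ (-(1 / 2) : ℝ) : H →L[ℂ] H) (f i)

end Frames

/-! ### Localization -/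

section Localization

variable {H : Type*} [NormedAddCommGroup H] [InnerProductSpace ℂ H] {I : Type*}
  {G : Type*} [AddCommGroup G]

/-- `(f, a)` is `ℓᵖ`-self-localized: there is `r ∈ ℓᵖ(G)` with
`|⟨f i, f j⟩| ≤ r (a i - a j)` for all `i, j`. -/
def IsSelfLocalized (p : ℝ≥0∞) (f : I → H) (a : I → G) : Prop :=
  ∃ r : lp (fun _ : G => ℝ) p, ∀ i j, ‖inner ℂ (f i) (f j)‖ ≤ r (a i - a j)

/-- `(f, a)` is `ℓᵖ`-localized with respect to its canonical dual frame `f'`: there is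
`r ∈ ℓᵖ(G)` with `|⟨f i, f' j⟩| ≤ r (a i - a j)` for all `i, j`. -/
def IsDualLocalized [CompleteSpace H] (p : ℝ≥0∞) (f : I → H) (hf : IsFrame f) (a : I → G) :
    Prop :=
  ∃ r : lp (fun _ : G => ℝ) p, ∀ i j, ‖inner ℂ (f i) (canonicalDual f hf j)‖ ≤ r (a i - a j)

end Localization

end LocalizedFrames

end

noncomputable section

namespace LocalizedFrames

/-! ### A vector-valued Wiener lemma -/

section Wiener

variable {𝔄 : Type*} [NormedRing 𝔄] [NormedAlgebra ℂ 𝔄] [CompleteSpace 𝔄]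

/-! Let `T` be the analysis operator, `S = T*T` and `V = TT*` the Gram matrix of the frame, which
has summable off-diagonal decay by hypothesis. The matrices of `⟨f i, S⁻¹ f j⟩` and `⟨f i, S⁻² f j⟩`
are `T S⁻¹ T*` and `T S⁻² T*`, that is, the projection onto the range of `V` and the pseudoinverse
of `V`. Both are contour integrals of the resolvent of `V`, with weights `1` and `1/λ`, over a
circle `λ = c + Rζ` that surrounds `[A, B]` and leaves `0` outside. It suffices that the Fourier
coefficients in `ζ` of the resolvent decay summably, off the diagonal and in the frequency.

This is a Wiener lemma. Finite density bounds the fibres of `a`, so `V` is a norm-summable sum of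
side diagonals `D g`. Conjugation by the diagonal unitary `χ (a i)` turns `V` into `∑ χ g • D g`, so
the Fourier transform of the family `c + Rζ - D` on `G × ℤ` is pointwise invertible. The
Bochner–Phillips theorem (`exists_convolution_eq_single`) then gives a summable convolution inverse.
It rests on the fact that central elements act as scalars modulo a maximal left ideal, so that a
central representation of `G` becomes a character there.

No integral is taken: the columns of the inverse are bounded solutions of a two-term recursion, from
which `pseudoinverse_of_recursion` reads off both matrices. Only a right inverse is needed. -/

/-- Modulo a maximal left ideal of a complex Banach algebra, a central element is a scalar. -/
theorem exists_sub_algebraMap_mem_of_central (J : Ideal 𝔄) [hJ : J.IsMaximal] {z : 𝔄}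
    (hz : ∀ x, z * x = x * z) : ∃ c : ℂ, z - algebraMap ℂ 𝔄 c ∈ J := by
  have hcl : IsClosed (J : Set 𝔄) := Ideal.IsMaximal.isClosed
  have hne : Nontrivial (𝔄 ⧸ J) :=
    Submodule.Quotient.nontrivial_iff.2 hJ.ne_top
  let Zl : (𝔄 ⧸ J) →ₗ[ℂ] (𝔄 ⧸ J) :=
    { toFun := fun x => z • x
      map_add' := smul_add z
      map_smul' := fun c x => by
        obtain ⟨x, rfl⟩ := Submodule.Quotient.mk_surjective J x
        simp only [← Submodule.Quotient.mk_smul, RingHom.id_apply]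
        congr 1
        simp }
  let Z : (𝔄 ⧸ J) →L[ℂ] (𝔄 ⧸ J) := Zl.mkContinuous ‖z‖ fun x => by
    refine le_of_forall_pos_le_add fun ε hε => ?_
    -- A nearly minimal representative of the class; the `+ 1` covers `z = 0`.
    obtain ⟨m, rfl, hm⟩ := Submodule.Quotient.norm_mk_lt x (ε := ε / (‖z‖ + 1)) (by positivity)
    refine (Submodule.Quotient.norm_mk_le J (z • m)).trans ((norm_mul_le z m).trans ?_)
    refine (mul_le_mul_of_nonneg_left hm.le (norm_nonneg z)).trans ?_
    rw [mul_add, mul_div_assoc']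
    gcongr
    rw [div_le_iff₀ (by positivity)]
    nlinarith
  -- Schur's lemma with Gelfand–Mazur: if `z - c` were not in `J`, maximality of `J` would make `c -
  -- Z` bijective, although `c` lies in the spectrum of `Z`.
  obtain ⟨c, hc⟩ := spectrum.nonempty Z
  refine ⟨c, ?_⟩
  by_contra hmem
  have hw : ∀ x, (z - algebraMap ℂ 𝔄 c) * x = x * (z - algebraMap ℂ 𝔄 c) := fun x => by
    rw [sub_mul, mul_sub, hz, Algebra.commutes]
  set w := z - algebraMap ℂ 𝔄 c with hwdef
  have hZ : ∀ x : 𝔄, (algebraMap ℂ ((𝔄 ⧸ J) →L[ℂ] (𝔄 ⧸ J)) c - Z) (Submodule.Quotient.mk x)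
      = - Submodule.Quotient.mk (w * x) := fun x => by
    change c • (Submodule.Quotient.mk x : 𝔄 ⧸ J) - z • (Submodule.Quotient.mk x : 𝔄 ⧸ J) = _
    rw [← Submodule.Quotient.mk_smul, ← Submodule.Quotient.mk_smul, ← Submodule.Quotient.mk_sub,
      ← Submodule.Quotient.mk_neg]
    congr 1
    rw [hwdef, sub_mul, smul_eq_mul, Algebra.smul_def, neg_sub]
  refine hc (ContinuousLinearMap.isUnit_iff_bijective.2 ⟨?_, ?_⟩)
  · rw [injective_iff_map_eq_zero]
    intro x hx
    obtain ⟨x, rfl⟩ := Submodule.Quotient.mk_surjective J x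
    rw [hZ, neg_eq_zero, Submodule.Quotient.mk_eq_zero] at hx
    -- The preimage of `J` under multiplication by `w` is a left ideal because `w` is central; it is
    -- proper and contains `J`, hence equals it.
    let J' : Ideal 𝔄 :=
      { carrier := {y | w * y ∈ J}
        add_mem' := fun {a b} ha hb => by
          simpa [mul_add] using J.add_mem ha hb
        zero_mem' := by simp
        smul_mem' := fun r y hy => by
          simp only [Set.mem_ofPred_eq, smul_eq_mul] at hy ⊢
          rw [← mul_assoc, hw, mul_assoc]
          exact J.mul_mem_left r hy }
    have hle : J ≤ J' := fun y hy => J.mul_mem_left w hy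
    have hJ' : J = J' := hJ.eq_of_le (fun h => hmem (by
      have h1 : (1 : 𝔄) ∈ J' := h ▸ Submodule.mem_top
      simpa [J'] using h1)) hle
    rw [Submodule.Quotient.mk_eq_zero, hJ']
    exact hx
  · intro x
    obtain ⟨x, rfl⟩ := Submodule.Quotient.mk_surjective J x
    have htop : J ⊔ Ideal.span {w} = ⊤ := by
      refine hJ.out.2 _ (lt_of_le_of_ne le_sup_left fun h => hmem ?_)
      rw [h]
      exact Submodule.mem_sup_right (Ideal.subset_span rfl)
    obtain ⟨y, hy, v, hv, hyv⟩ := Submodule.mem_sup.1 (htop ▸ (Submodule.mem_top : x ∈ ⊤))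
    obtain ⟨u, rfl⟩ := Ideal.mem_span_singleton'.1 hv
    refine ⟨Submodule.Quotient.mk (-u), ?_⟩
    rw [hZ, ← Submodule.Quotient.mk_neg, Submodule.Quotient.eq, hw]
    have : -(-u * w) - x = -y := by rw [← hyv]; noncomm_ring
    rw [this]
    exact J.neg_mem hy

/-- If `u` is a representation of an abelian group by central contractions in a Banach algebra
and `∑ χ g • b g` is left invertible for each unitary character `χ`, then `∑ u g * b g` is left
invertible. -/
theorem exists_mul_tsum_eq_one_of_central {G : Type*} [AddCommGroup G] (u : G → 𝔄) (hu0 : u 0 = 1)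
    (hu : ∀ g h, u (g + h) = u g * u h) (huc : ∀ g x, u g * x = x * u g) (hu1 : ∀ g, ‖u g‖ ≤ 1)
    (b : G → 𝔄) (hb : Summable fun g => ‖b g‖)
    (h : ∀ χ : AddChar G ℂ, (∀ g, ‖χ g‖ = 1) → ∃ y, y * ∑' g, χ g • b g = 1) :
    ∃ y, y * ∑' g, u g * b g = 1 := by
  by_contra hcon
  set T := ∑' g, u g * b g with hT
  have hne : Ideal.span {T} ≠ ⊤ := fun htop => by
    obtain ⟨y, hy⟩ := Ideal.mem_span_singleton'.1 (htop ▸ (Submodule.mem_top : (1 : 𝔄) ∈ ⊤))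
    exact hcon ⟨y, hy⟩
  -- If `T` has no left inverse, it lies in a maximal left ideal, which is closed.
  obtain ⟨J, hJ, hle⟩ := Ideal.exists_le_maximal _ hne
  have hcl : IsClosed (J : Set 𝔄) := Ideal.IsMaximal.isClosed
  have h1 : (1 : 𝔄) ∉ J := (Ideal.ne_top_iff_one J).1 hJ.ne_top
  have hscalar : ∀ c : ℂ, algebraMap ℂ 𝔄 c ∈ J → c = 0 := fun c hc => by
    by_contra hc0
    refine h1 ?_
    have := J.mul_mem_left (algebraMap ℂ 𝔄 c⁻¹) hc
    rwa [← map_mul, inv_mul_cancel₀ hc0, map_one] at this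
  choose χ hχ using fun g => exists_sub_algebraMap_mem_of_central J (huc g)
  have hχ0 : χ 0 = 1 := by
    have := hχ 0
    rw [hu0, ← map_one (algebraMap ℂ 𝔄), ← map_sub] at this
    exact (sub_eq_zero.1 (hscalar _ this)).symm
  have hχadd : ∀ g h, χ (g + h) = χ g * χ h := fun g h => by
    have h2 := J.mul_mem_left (u g) (hχ h)
    have h3 := J.mul_mem_left (algebraMap ℂ 𝔄 (χ h)) (hχ g)
    have h4 := J.sub_mem (J.add_mem h2 h3) (hχ (g + h))
    refine sub_eq_zero.1 (hscalar _ ?_)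
    convert h4 using 1
    rw [map_sub, map_mul, hu, mul_sub, mul_sub, ← Algebra.commutes (χ h) (u g),
      ← map_mul, ← map_mul, mul_comm (χ h)]
    abel
  -- A scalar outside the unit disc is not in the spectrum of the contraction `u g`, so `J` would
  -- contain a unit.
  have hχle : ∀ g, ‖χ g‖ ≤ 1 := fun g => by
    by_contra! hlt
    have hunit : IsUnit (algebraMap ℂ 𝔄 (χ g) - u g) := by
      have : χ g ∉ spectrum ℂ (u g) := fun hs => by
        have h5 := spectrum.norm_le_norm_mul_of_mem hs
        have h6 : ‖(1 : 𝔄)‖ ≤ 1 := hu0 ▸ hu1 0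
        have h7 : ‖u g‖ * ‖(1 : 𝔄)‖ ≤ 1 := mul_le_one₀ (hu1 g) (norm_nonneg _) h6
        linarith
      exact spectrum.notMem_iff.1 this
    obtain ⟨v, hv⟩ := hunit.exists_left_inv
    refine h1 (hv ▸ J.mul_mem_left v ?_)
    rw [← neg_sub]
    exact J.neg_mem (hχ g)
  have hχ1 : ∀ g, ‖χ g‖ = 1 := fun g => by
    have h8 : ‖χ g‖ * ‖χ (-g)‖ = 1 := by rw [← norm_mul, ← hχadd, add_neg_cancel, hχ0, norm_one]
    have := hχle g
    have := hχle (-g)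
    have := norm_nonneg (χ g)
    nlinarith
  obtain ⟨y, hy⟩ := h ⟨χ, hχ0, hχadd⟩ hχ1
  simp only [AddChar.coe_mk] at hy
  have hs1 : Summable fun g => u g * b g := by
    refine Summable.of_norm_bounded hb fun g => (norm_mul_le _ _).trans ?_
    exact mul_le_of_le_one_left (norm_nonneg _) (hu1 g)
  have hs2 : Summable fun g => χ g • b g := by
    refine Summable.of_norm_bounded hb fun g => (norm_smul_le _ _).trans_eq ?_
    rw [hχ1, one_mul]
  -- As `J` is closed, `T` may be replaced modulo `J` by its transform at `χ`; the latter is left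
  -- invertible, so `1 ∈ J`.
  have hdiff : T - ∑' g, χ g • b g ∈ J := by
    rw [hT, ← hs1.tsum_sub hs2]
    refine hcl.mem_of_tendsto (hs1.sub hs2).hasSum (Filter.Eventually.of_forall fun s => ?_)
    refine J.sum_mem fun g _ => ?_
    have : u g * b g - χ g • b g = b g * (u g - algebraMap ℂ 𝔄 (χ g)) := by
      rw [mul_sub, huc, Algebra.smul_def, Algebra.commutes]
    rw [this]
    exact J.mul_mem_left _ (hχ g)
  have hTJ : T ∈ J := hle (Ideal.subset_span rfl)
  refine h1 (hy ▸ J.mul_mem_left y ?_)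
  have := J.sub_mem hTJ hdiff
  rwa [sub_sub_cancel] at this

/-- The left-sided result in the opposite algebra; centrality of `u` restores the order of the
factors. -/
theorem exists_tsum_mul_eq_one_of_central {G : Type*} [AddCommGroup G] (u : G → 𝔄) (hu0 : u 0 = 1)
    (hu : ∀ g h, u (g + h) = u g * u h) (huc : ∀ g x, u g * x = x * u g) (hu1 : ∀ g, ‖u g‖ ≤ 1)
    (b : G → 𝔄) (hb : Summable fun g => ‖b g‖)
    (h : ∀ χ : AddChar G ℂ, (∀ g, ‖χ g‖ = 1) → ∃ y, (∑' g, χ g • b g) * y = 1) :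
    ∃ y, (∑' g, u g * b g) * y = 1 := by
  obtain ⟨y, hy⟩ := exists_mul_tsum_eq_one_of_central (𝔄 := 𝔄ᵐᵒᵖ)
    (fun g => MulOpposite.op (u g)) (by simp [hu0])
    (fun g h => by rw [add_comm, hu, MulOpposite.op_mul])
    (fun g x => by
      rw [← MulOpposite.op_unop x, ← MulOpposite.op_mul, ← MulOpposite.op_mul, huc])
    hu1 (fun g => MulOpposite.op (b g)) hb
    (fun χ hχ => by
      obtain ⟨y, hy⟩ := h χ hχ
      refine ⟨MulOpposite.op y, ?_⟩
      rw [← MulOpposite.op_one, ← hy, MulOpposite.op_mul]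
      congr 1
      simp only [← MulOpposite.op_smul, tsum_op])
  refine ⟨y.unop, MulOpposite.op_injective ?_⟩
  rw [MulOpposite.op_mul, MulOpposite.op_unop, MulOpposite.op_one, ← hy]
  congr 1
  simp only [tsum_op, ← MulOpposite.op_mul, huc]

end Wiener

/-! ### Translations on the Banach space `ℓ¹(G, E)`. -/

section SummableFamilies

variable {ι : Type*} {E : Type*} [NormedAddCommGroup E]

theorem memℓp_one_iff {x : ι → E} : Memℓp x 1 ↔ Summable fun i => ‖x i‖ := by
  simpa using memℓp_gen_iff (E := fun _ : ι => E) (p := 1) (f := x) (by simp)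

theorem lp_one_summable (x : lp (fun _ : ι => E) 1) : Summable fun i => ‖x i‖ :=
  memℓp_one_iff.1 (lp.memℓp x)

theorem lp_one_norm (x : lp (fun _ : ι => E) 1) : ‖x‖ = ∑' i, ‖x i‖ := by
  simpa using lp.norm_eq_tsum_rpow (p := 1) (by simp) x

variable [NormedSpace ℂ E]

/-- Translation on `ℓ¹(G, E)`. -/
def translate {G : Type*} [AddCommGroup G] (g : G) :
    lp (fun _ : G => E) 1 →L[ℂ] lp (fun _ : G => E) 1 :=
  LinearMap.mkContinuous
    { toFun := fun x => ⟨fun m => x (m - g), memℓp_one_iff.2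
        ((lp_one_summable x).comp_injective (Equiv.subRight g).injective)⟩
      map_add' := fun x y => by ext; rfl
      map_smul' := fun c x => by ext; rfl } 1 (fun x => by
        rw [one_mul, lp_one_norm, lp_one_norm]
        exact ((Equiv.subRight g).tsum_eq fun m => ‖x m‖).le)

theorem norm_translate_le {G : Type*} [AddCommGroup G] (g : G) :
    ‖(translate g : lp (fun _ : G => E) 1 →L[ℂ] lp (fun _ : G => E) 1)‖ ≤ 1 :=
  LinearMap.mkContinuous_norm_le _ zero_le_one _

end SummableFamilies

/-! ### Inversion in the commutant of a group representation. -/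

section Commutant

variable {𝔅 : Type*} [NormedRing 𝔅] [NormedAlgebra ℂ 𝔅] {G : Type*} [AddCommGroup G]
  {X : Type*} [NormedAddCommGroup X] [NormedSpace ℂ X] [CompleteSpace X]

/-- Given commuting representations of a discrete abelian group `G` by contractions and of a Banach
algebra `𝔅` on a Banach space, `∑ τ g * π (b g)` is right invertible as soon as the Fourier
transform of `b` is pointwise right invertible. -/
theorem exists_hasSum_of_commute (τ : G → X →L[ℂ] X) (hτ0 : τ 0 = 1)
    (hτ : ∀ g h, τ (g + h) = τ g * τ h) (hτ1 : ∀ g, ‖τ g‖ ≤ 1) (π : 𝔅 →L[ℂ] X →L[ℂ] X)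
    (hπ1 : π 1 = 1) (hπ : ∀ a b, π (a * b) = π a * π b)
    (hcomm : ∀ g b, τ g * π b = π b * τ g) (b : G → 𝔅) (hb : Summable fun g => ‖b g‖)
    (h : ∀ χ : AddChar G ℂ, (∀ g, ‖χ g‖ = 1) → ∃ y, (∑' g, χ g • b g) * y = 1)
    (hs : ∀ χ : AddChar G ℂ, (∀ g, ‖χ g‖ = 1) → Summable fun g => χ g • b g) :
    ∃ L : X →L[ℂ] X, ∀ x, HasSum (fun g => τ g (π (b g) (L x))) x := by
  -- The centralizer of the range of `τ` is a Banach algebra. It contains each `τ g`, because `G` is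
  -- abelian, and each `π b`; the `τ g` are central in it by definition.
  let C : Subalgebra ℂ (X →L[ℂ] X) := Subalgebra.centralizer ℂ (Set.range τ)
  have hCc : IsClosed (C : Set (X →L[ℂ] X)) := Set.isClosed_centralizer _
  have : CompleteSpace C := hCc.completeSpace_coe
  have hτC : ∀ g, τ g ∈ C := by
    rintro g _ ⟨k, rfl⟩
    rw [← hτ, ← hτ, add_comm]
  have hπC : ∀ a, π a ∈ C := by
    rintro a _ ⟨k, rfl⟩
    exact hcomm k a
  have hinj : Function.Injective (Subtype.val : C → X →L[ℂ] X) := Subtype.val_injective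
  have hval : ∀ (f : G → C), Summable f → ((∑' g, f g : C) : X →L[ℂ] X) = ∑' g, (f g : X →L[ℂ] X) :=
    fun f hf => (hf.hasSum.map C.val.toLinearMap.toAddMonoidHom continuous_subtype_val).tsum_eq.symm
  have hn : Summable fun g => ‖π (b g)‖ :=
    Summable.of_nonneg_of_le (fun _ => norm_nonneg _) (fun g => π.le_opNorm _) (hb.mul_left ‖π‖)
  have hnC : Summable fun g => ‖(⟨π (b g), hπC _⟩ : C)‖ := hn
  obtain ⟨L, hL⟩ := exists_tsum_mul_eq_one_of_central (fun g => (⟨τ g, hτC g⟩ : C))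
    (hinj hτ0) (fun g k => hinj (hτ g k)) (fun g x => hinj (x.2 _ ⟨g, rfl⟩)) hτ1
    (fun g => ⟨π (b g), hπC _⟩) hnC (fun χ hχ => by
      obtain ⟨y, hy⟩ := h χ hχ
      refine ⟨⟨π y, hπC y⟩, hinj ?_⟩
      have hs' : Summable fun g => χ g • (⟨π (b g), hπC _⟩ : C) :=
        Summable.of_norm_bounded hnC fun g =>
          (norm_smul_le _ _).trans (by rw [hχ, one_mul]; exact le_rfl)
      change ((∑' g, χ g • (⟨π (b g), hπC _⟩ : C) : C) : X →L[ℂ] X) * π y = 1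
      rw [hval _ hs', ← hπ1, ← hy, hπ, ContinuousLinearMap.map_tsum _ (hs χ hχ)]
      congr 1
      exact tsum_congr fun g => (map_smul π _ _).symm)
  refine ⟨L, fun x => ?_⟩
  have hs1 : Summable fun g => τ g * π (b g) :=
    Summable.of_norm_bounded hn fun g => (norm_mul_le _ _).trans
      (mul_le_of_le_one_left (norm_nonneg _) (hτ1 g))
  have hs2 : Summable fun g => (⟨τ g, hτC g⟩ : C) * ⟨π (b g), hπC _⟩ :=
    Summable.of_norm_bounded hnC fun g => (norm_mul_le _ _).trans
      (mul_le_of_le_one_left (norm_nonneg _) (hτ1 g))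
  have h1 := congrArg (Subtype.val : C → X →L[ℂ] X) hL
  have h2 := hval _ hs2
  have h3 : (∑' g, τ g * π (b g)) * (L : X →L[ℂ] X) = 1 :=
    (congrArg (· * (L : X →L[ℂ] X)) h2.symm).trans h1
  have h4 := hs1.hasSum.mapL (ContinuousLinearMap.apply ℂ X ((L : X →L[ℂ] X) x))
  have h5 : ContinuousLinearMap.apply ℂ X ((L : X →L[ℂ] X) x) (∑' g, τ g * π (b g)) = x :=
    DFunLike.congr_fun h3 x
  rwa [h5] at h4

end Commutant

/-! ### Convolution inverses in `ℓ¹(G, 𝔅)`. -/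

section Convolution

variable {𝔅 : Type*} [NormedRing 𝔅] [NormedAlgebra ℂ 𝔅] {G : Type*}

/-- Pointwise left multiplication on `ℓ¹(G, 𝔅)`. -/
def leftMul (b : 𝔅) : lp (fun _ : G => 𝔅) 1 →L[ℂ] lp (fun _ : G => 𝔅) 1 :=
  LinearMap.mkContinuous
    { toFun := fun x => ⟨fun m => b * x m, memℓp_one_iff.2
        (Summable.of_nonneg_of_le (fun _ => norm_nonneg _) (fun _ => norm_mul_le _ _)
          ((lp_one_summable x).mul_left ‖b‖))⟩
      map_add' := fun x y => by ext m; exact mul_add b (x m) (y m)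
      map_smul' := fun c x => by ext m; exact mul_smul_comm c b (x m) } ‖b‖ (fun x => by
        rw [lp_one_norm, lp_one_norm, ← tsum_mul_left]
        refine Summable.tsum_le_tsum (fun m => norm_mul_le _ _) ?_
          ((lp_one_summable x).mul_left ‖b‖)
        exact Summable.of_nonneg_of_le (fun _ => norm_nonneg _) (fun _ => norm_mul_le _ _)
          ((lp_one_summable x).mul_left ‖b‖))

theorem norm_leftMul_le (b : 𝔅) :
    ‖(leftMul b : lp (fun _ : G => 𝔅) 1 →L[ℂ] lp (fun _ : G => 𝔅) 1)‖ ≤ ‖b‖ :=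
  LinearMap.mkContinuous_norm_le _ (norm_nonneg b) _

/-- `leftMul` as a linear map in the multiplier. -/
def leftMulₗ : 𝔅 →ₗ[ℂ] (lp (fun _ : G => 𝔅) 1 →L[ℂ] lp (fun _ : G => 𝔅) 1) where
  toFun b := leftMul b
  map_add' b c := by ext x m; exact add_mul b c (x m)
  map_smul' k b := by ext x m; exact smul_mul_assoc k b (x m)

variable (𝔅 G) in
/-- `leftMul` as a continuous linear map in the multiplier. -/
def leftMulCLM : 𝔅 →L[ℂ] (lp (fun _ : G => 𝔅) 1 →L[ℂ] lp (fun _ : G => 𝔅) 1) :=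
  { leftMulₗ with
    cont := AddMonoidHomClass.continuous_of_bound (leftMulₗ (𝔅 := 𝔅) (G := G)) 1 fun b =>
      (norm_leftMul_le (G := G) b).trans_eq (one_mul _).symm }

variable [AddCommGroup G] [CompleteSpace 𝔅]

/-- **Bochner–Phillips theorem**, one-sided: a summable family `b` on a discrete abelian group with
values in a Banach algebra has a right inverse for convolution as soon as its Fourier transform is
pointwise right invertible. -/
theorem exists_convolution_eq_single [DecidableEq G] (b : G → 𝔅) (hb : Summable fun g => ‖b g‖)
    (h : ∀ χ : AddChar G ℂ, (∀ g, ‖χ g‖ = 1) → ∃ y, (∑' g, χ g • b g) * y = 1) :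
    ∃ F : G → 𝔅, (Summable fun g => ‖F g‖) ∧
      ∀ m, HasSum (fun g => b g * F (m - g)) (if m = 0 then 1 else 0) := by
  obtain ⟨L, hL⟩ := exists_hasSum_of_commute
    (translate : G → lp (fun _ : G => 𝔅) 1 →L[ℂ] lp (fun _ : G => 𝔅) 1)
    (by ext x m; change (x (m - 0) : 𝔅) = x m; rw [sub_zero])
    (fun g k => by
      ext x m; change (x (m - (g + k)) : 𝔅) = x (m - g - k); rw [sub_add_eq_sub_sub])
    norm_translate_le (leftMulCLM 𝔅 G)
    (by ext x m; exact one_mul (x m)) (fun b c => by ext x m; exact mul_assoc b c (x m))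
    (fun g b => rfl) b hb h (fun χ hχ =>
      Summable.of_norm_bounded hb fun g => (norm_smul_le _ _).trans_eq (by rw [hχ, one_mul]))
  -- The convolution inverse is the image under `L` of the unit mass at `0`.
  refine ⟨_, lp_one_summable (L (lp.single 1 0 1)), fun m => ?_⟩
  have h1 : lp.evalCLM ℂ (fun _ : G => 𝔅) 1 m (lp.single 1 0 1) = if m = 0 then 1 else 0 := by
    change (lp.single (E := fun _ : G => 𝔅) 1 0 (1 : 𝔅) : lp (fun _ : G => 𝔅) 1) m = _
    rw [lp.single_apply, Pi.single_apply]
  rw [← h1]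
  exact (hL (lp.single 1 0 1)).mapL (lp.evalCLM ℂ (fun _ : G => 𝔅) 1 m)

end Convolution

/-! ### Matrices acting on `ℓ²` -/

/-- The Hilbert space `ℓ²(I)`. -/
abbrev L2 (I : Type*) : Type _ := lp (fun _ : I => ℂ) 2

section MatrixOperators

variable {I : Type*}

theorem sum_norm_sq_le (x : L2 I) (s : Finset I) : ∑ i ∈ s, ‖x i‖ ^ 2 ≤ ‖x‖ ^ 2 := by
  simpa using lp.sum_rpow_le_norm_rpow (p := 2) (by simp) x s

/-- Schur's test for a matrix all of whose rows and columns have at most `K` nonzero entries, of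
size at most `ρ`. -/
theorem exists_sparse_operator (F : I → Finset I) (m : I → I → ℂ) (K : ℕ) (ρ : ℝ)
    (hρ : 0 ≤ ρ) (hrow : ∀ i, (F i).card ≤ K)
    (hcol : ∀ (j : I) (s : Finset I), (∀ i ∈ s, j ∈ F i) → s.card ≤ K)
    (hm : ∀ i, ∀ j ∈ F i, ‖m i j‖ ≤ ρ) :
    ∃ T : L2 I →L[ℂ] L2 I, (∀ x i, T x i = ∑ j ∈ F i, m i j * x j) ∧ ‖T‖ ≤ K * ρ := by
  classical
  have key : ∀ (x : L2 I) (s : Finset I),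
      ∑ i ∈ s, ‖∑ j ∈ F i, m i j * x j‖ ^ 2 ≤ (K * ρ * ‖x‖) ^ 2 := fun x s => by
    calc ∑ i ∈ s, ‖∑ j ∈ F i, m i j * x j‖ ^ 2
        ≤ ∑ i ∈ s, ∑ j ∈ F i, K * ρ ^ 2 * ‖x j‖ ^ 2 := by
          refine Finset.sum_le_sum fun i _ => ?_
          have h1 : ‖∑ j ∈ F i, m i j * x j‖ ≤ ∑ j ∈ F i, ρ * ‖x j‖ := by
            refine norm_sum_le_of_le _ fun j hj => ?_
            rw [norm_mul]
            exact mul_le_mul_of_nonneg_right (hm i j hj) (norm_nonneg _)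
          calc ‖∑ j ∈ F i, m i j * x j‖ ^ 2 ≤ (∑ j ∈ F i, ρ * ‖x j‖) ^ 2 := by gcongr
            _ ≤ (F i).card * ∑ j ∈ F i, (ρ * ‖x j‖) ^ 2 := sq_sum_le_card_mul_sum_sq
            _ ≤ K * ∑ j ∈ F i, (ρ * ‖x j‖) ^ 2 := by
              gcongr
              exact hrow i
            _ = _ := by
              rw [Finset.mul_sum]
              exact Finset.sum_congr rfl fun j _ => by ring
      _ = ∑ j ∈ s.biUnion F, ∑ i ∈ s with j ∈ F i, K * ρ ^ 2 * ‖x j‖ ^ 2 := by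
          refine Finset.sum_comm' fun i j => ?_
          simp only [Finset.mem_biUnion, Finset.mem_filter]
          exact ⟨fun ⟨hi, hj⟩ => ⟨⟨hi, hj⟩, i, hi, hj⟩, fun ⟨h, _⟩ => h⟩
      _ ≤ ∑ j ∈ s.biUnion F, K * (K * ρ ^ 2 * ‖x j‖ ^ 2) := by
          refine Finset.sum_le_sum fun j _ => ?_
          rw [Finset.sum_const, nsmul_eq_mul]
          gcongr
          exact hcol j _ fun i hi => (Finset.mem_filter.1 hi).2
      _ = (K * ρ) ^ 2 * ∑ j ∈ s.biUnion F, ‖x j‖ ^ 2 := by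
          rw [Finset.mul_sum]
          exact Finset.sum_congr rfl fun j _ => by ring
      _ ≤ (K * ρ) ^ 2 * ‖x‖ ^ 2 := by
          gcongr
          exact sum_norm_sq_le x _
      _ = _ := by ring
  have hmem : ∀ x : L2 I, Memℓp (fun i => ∑ j ∈ F i, m i j * x j) 2 := fun x =>
    memℓp_gen' (C := (K * ρ * ‖x‖) ^ 2) fun s => by simpa using key x s
  let T : L2 I →ₗ[ℂ] L2 I :=
    { toFun := fun x => ⟨fun i => ∑ j ∈ F i, m i j * x j, hmem x⟩
      map_add' := fun x y => by
        ext i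
        change ∑ j ∈ F i, m i j * (x j + y j) = ∑ j ∈ F i, m i j * x j + ∑ j ∈ F i, m i j * y j
        simp only [mul_add, Finset.sum_add_distrib]
      map_smul' := fun c x => by
        ext i
        change ∑ j ∈ F i, m i j * (c * x j) = c * ∑ j ∈ F i, m i j * x j
        rw [Finset.mul_sum]
        exact Finset.sum_congr rfl fun j _ => by ring }
  have hT : ∀ x, ‖T x‖ ≤ K * ρ * ‖x‖ := fun x =>
    lp.norm_le_of_forall_sum_le (by simp) (by positivity) fun s => by
      have := key x s
      simpa [T] using this
  exact ⟨T.mkContinuous (K * ρ) hT, fun x i => rfl, T.mkContinuous_norm_le (by positivity) hT⟩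

theorem exists_diagonal_operator (c : I → ℂ) (hc : ∀ i, ‖c i‖ ≤ 1) :
    ∃ T : L2 I →L[ℂ] L2 I, (∀ x i, T x i = c i * x i) ∧ ‖T‖ ≤ 1 := by
  obtain ⟨T, h1, h2⟩ := exists_sparse_operator (fun i => {i}) (fun i _ => c i) 1 1 zero_le_one
    (fun i => by simp)
    (fun j s hs => Finset.card_le_one.2 fun i hi k hk =>
      (Finset.mem_singleton.1 (hs i hi)).symm.trans (Finset.mem_singleton.1 (hs k hk)))
    (fun i j _ => hc i)
  exact ⟨T, by simpa using h1, by simpa using h2⟩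

variable {G : Type*} [AddCommGroup G]

/-- The side diagonals of a matrix with summable off-diagonal decay. -/
theorem exists_side_diagonals (a : I → G) (fib : G → Finset I) (hfib : ∀ g i, i ∈ fib g ↔ a i = g)
    (K : ℕ) (hK : ∀ g, (fib g).card ≤ K) [DecidableEq I] (V : L2 I →L[ℂ] L2 I) (r : G → ℝ)
    (hr : Summable fun g => ‖r g‖)
    (hV : ∀ i j, ‖V (lp.single 2 j 1) i‖ ≤ r (a i - a j)) :
    ∃ D : G → L2 I →L[ℂ] L2 I, (Summable fun g => ‖D g‖) ∧ HasSum D V ∧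
      ∀ g x i, D g x i = ∑ j ∈ fib (a i - g), V (lp.single 2 j 1) i * x j := by
  classical
  choose D hD hDn using fun g => exists_sparse_operator (fun i => fib (a i - g))
    (fun i j => V (lp.single 2 j 1) i) K ‖r g‖ (norm_nonneg _) (fun i => hK _)
    -- Column `j` of the diagonal `g` is supported in the fibre over `a j + g`.
    (fun j s hs => (Finset.card_le_card fun i hi => by
      have := (hfib _ _).1 (hs i hi)
      exact (hfib (a j + g) i).2 (by rw [this]; abel)).trans (hK (a j + g)))
    (fun i j hj => by
      have h1 := (hfib _ _).1 hj
      refine (hV i j).trans ((le_abs_self _).trans_eq ?_)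
      rw [h1, sub_sub_cancel, Real.norm_eq_abs])
  have hs : Summable fun g => ‖D g‖ :=
    Summable.of_nonneg_of_le (fun _ => norm_nonneg _) hDn (hr.mul_left _)
  refine ⟨D, hs, ?_, hD⟩
  have hs' : HasSum D (∑' g, D g) := hs.of_norm.hasSum
  convert hs' using 1
  -- Bounded operators on `ℓ²` are determined by their entries, and entry `(i, j)` of the sum comes
  -- from the single diagonal `g = a i - a j`.
  refine lp.ext_continuousLinearMap (by simp) fun j => ContinuousLinearMap.ext_ring ?_
  ext i
  have h1 := (hs'.mapL (ContinuousLinearMap.apply ℂ (L2 I) (lp.single 2 j 1))).mapL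
    (lp.evalCLM ℂ (fun _ : I => ℂ) 2 i)
  refine HasSum.unique ?_ h1
  have h2 : ∀ g, (lp.evalCLM ℂ (fun _ : I => ℂ) 2 i)
      (ContinuousLinearMap.apply ℂ (L2 I) (lp.single 2 j 1) (D g)) =
      if g = a i - a j then V (lp.single 2 j 1) i else 0 := fun g => by
    refine (hD g _ i).trans ?_
    have h3 : ∀ k, V (lp.single 2 k 1) i * (lp.single (E := fun _ : I => ℂ) 2 j 1 : L2 I) k
        = if k = j then V (lp.single 2 j 1) i else 0 := fun k => by
      rw [lp.single_apply, Pi.single_apply]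
      split_ifs with h
      · rw [h, mul_one]
      · rw [mul_zero]
    simp only [h3, Finset.sum_ite_eq', hfib]
    refine if_congr ?_ rfl rfl
    rw [eq_sub_iff_add_eq, eq_sub_iff_add_eq, add_comm]
  simp only [h2]
  exact hasSum_ite_eq _ _

end MatrixOperators

/-! ### Fourier coefficients of the resolvent on a circle. -/

section Resolvent

theorem hasSum_ite_snd {G M : Type*} [AddCommMonoid M] [TopologicalSpace M] {φ : G → M} {S : M}
    (h : HasSum φ S) : HasSum (fun p : G × ℤ => if p.2 = 0 then φ p.1 else 0) S := by
  have hinj : Function.Injective fun g : G => (g, (0 : ℤ)) := fun g h hgh => (Prod.ext_iff.1 hgh).1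
  refine (hinj.hasSum_iff ?_).1 (by simpa [Function.comp_def] using h)
  rintro ⟨g, n⟩ hp
  refine if_neg fun hn => hp ⟨g, ?_⟩
  simp only at hn
  rw [hn]

variable {𝔅 : Type*} [NormedRing 𝔅] [NormedAlgebra ℂ 𝔅] [CompleteSpace 𝔅]
  {G : Type*} [AddCommGroup G]

/-- If `c + R ζ - ∑ χ g • D g` is right invertible for all unimodular `ζ` and all unitary
characters `χ`, then the Fourier coefficients of a right inverse form a summable family `F`; they
satisfy the resulting recursion. -/
theorem exists_resolvent_coefficients [DecidableEq G] (D : G → 𝔅) (hD : Summable fun g => ‖D g‖)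
    (c R : ℂ)
    (h : ∀ (χ : AddChar G ℂ) (ζ : ℂ), (∀ g, ‖χ g‖ = 1) → ‖ζ‖ = 1 →
      ∃ y, (c • (1 : 𝔅) + (R * ζ) • (1 : 𝔅) - ∑' g, χ g • D g) * y = 1) :
    ∃ F : G × ℤ → 𝔅, (Summable fun p => ‖F p‖) ∧ ∀ k n,
      HasSum (fun g => D g * F (k - g, n))
        (c • F (k, n) + R • F (k, n - 1) - if k = 0 ∧ n = 0 then 1 else 0) := by
  -- The symbol `c + Rζ - D`: its transform at a character of `G × ℤ` has `ζ` equal to the value at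
  -- `(0, 1)`.
  let b : G × ℤ → 𝔅 := fun p => (if p = (0, 0) then c • 1 else 0) +
    (if p = (0, 1) then R • 1 else 0) - if p.2 = 0 then D p.1 else 0
  -- The additive map `ψ` is left free so that one computation serves both the Fourier transform and
  -- the convolution with `F`.
  have hb : ∀ (ψ : G × ℤ → 𝔅 →+ 𝔅) (S : 𝔅), HasSum (fun g => ψ (g, 0) (D g)) S →
      HasSum (fun p => ψ p (b p)) (ψ (0, 0) (c • 1) + ψ (0, 1) (R • 1) - S) := fun ψ S hS => by
    have h1 := ((hasSum_ite_eq ((0 : G), (0 : ℤ)) (ψ (0, 0) (c • 1))).add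
      (hasSum_ite_eq ((0 : G), (1 : ℤ)) (ψ (0, 1) (R • 1)))).sub (hasSum_ite_snd hS)
    refine h1.congr_fun ?_
    rintro ⟨g, n⟩
    simp only [b, map_sub, map_add]
    congr 1
    · congr 1
      · split_ifs with h2
        · rw [h2]
        · rw [map_zero]
      · split_ifs with h2
        · rw [h2]
        · rw [map_zero]
    · split_ifs with h2
      · rw [h2]
      · rw [map_zero]
  have hbn : Summable fun p => ‖b p‖ := by
    have h1 := ((hasSum_ite_eq ((0 : G), (0 : ℤ)) ‖c • (1 : 𝔅)‖).add
      (hasSum_ite_eq ((0 : G), (1 : ℤ)) ‖R • (1 : 𝔅)‖)).add (hasSum_ite_snd hD.hasSum)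
    refine Summable.of_nonneg_of_le (fun _ => norm_nonneg _) (fun p => ?_) h1.summable
    refine (norm_sub_le _ _).trans (add_le_add ((norm_add_le _ _).trans (add_le_add ?_ ?_)) ?_)
    all_goals
      split_ifs
      · exact le_rfl
      · rw [norm_zero]
  obtain ⟨F, hF, hFeq⟩ := exists_convolution_eq_single b hbn fun χ hχ => by
    have hs : Summable fun g => χ (g, 0) • D g :=
      Summable.of_norm_bounded hD fun g => (norm_smul_le _ _).trans_eq (by rw [hχ, one_mul])
    obtain ⟨y, hy⟩ := h ⟨fun g => χ (g, 0), χ.map_zero_eq_one, fun g k => by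
      rw [← χ.map_add_eq_mul, Prod.mk_add_mk, add_zero]⟩ (χ (0, 1)) (fun g => hχ _) (hχ _)
    refine ⟨y, ?_⟩
    have h1 := hb (fun p => DistribSMul.toAddMonoidHom 𝔅 (χ p)) _ hs.hasSum
    simp only [DistribSMul.toAddMonoidHom_apply] at h1
    refine Eq.trans (congrArg (· * y) ?_) hy
    rw [h1.tsum_eq]
    have h2 : χ (0, 0) = 1 := χ.map_zero_eq_one
    rw [smul_smul (χ (0, 1)), mul_comm R, h2, one_smul]
    rfl
  refine ⟨F, hF, fun k n => ?_⟩
  obtain ⟨B, hB⟩ : ∃ B, ∀ p, ‖F p‖ ≤ B := ⟨_, fun p => hF.le_tsum p fun _ _ => norm_nonneg _⟩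
  have hs : Summable fun g => D g * F (k - g, n) :=
    Summable.of_norm_bounded (hD.mul_right B) fun g => (norm_mul_le _ _).trans
      (mul_le_mul_of_nonneg_left (hB _) (norm_nonneg _))
  have h1 := hb (fun p => AddMonoidHom.mulRight (F ((k, n) - p))) _ (by
    simpa using hs.hasSum)
  have h2 := h1.unique (hFeq (k, n))
  have h3 : (c • F (k, n) + R • F (k, n - 1) - if k = 0 ∧ n = 0 then 1 else 0)
      = ∑' g, D g * F (k - g, n) := by
    rw [sub_eq_iff_eq_add, ← sub_eq_iff_eq_add']
    simpa [Prod.mk_eq_zero] using h2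
  rw [h3]
  exact hs.hasSum

end Resolvent

/-! ### Off-diagonal decay of the resolvent coefficients. -/

section Columns

variable {I : Type*} {G : Type*} [AddCommGroup G]

/-- Grade `ℓ²(I)` by `a`, so that `D g` has degree `g`. The column `y n` collects, over all `h`, the
part of `F (h, n)` applied to the basis vector that has degree `h` relative to `a j`. Entry `i` then
involves only `h = a i - a j`, which gives the decay. -/
theorem exists_localized_columns [DecidableEq I] (a : I → G) (fib : G → Finset I)
    (hfib : ∀ g i, i ∈ fib g ↔ a i = g) (K : ℕ) (hK : ∀ g, (fib g).card ≤ K)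
    (V : L2 I →L[ℂ] L2 I) (r : G → ℝ) (hr : Summable fun g => ‖r g‖)
    (hV : ∀ i j, ‖V (lp.single 2 j 1) i‖ ≤ r (a i - a j)) (c R : ℂ)
    (hN : ∀ ζ : ℂ, ‖ζ‖ = 1 → ∃ N : L2 I →L[ℂ] L2 I,
      (c • (1 : L2 I →L[ℂ] L2 I) + (R * ζ) • (1 : L2 I →L[ℂ] L2 I) - V) * N = 1) :
    ∃ s : G × ℤ → ℝ, Summable s ∧ ∀ j, ∃ y : ℤ → L2 I, (∃ C, ∀ n, ‖y n‖ ≤ C) ∧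
      (∀ n, c • y n + R • y (n - 1) - V (y n) = if n = 0 then lp.single 2 j 1 else 0) ∧
      ∀ n i, ‖y n i‖ ≤ s (a i - a j, n) := by
  classical
  obtain ⟨D, hDn, hDV, hD⟩ := exists_side_diagonals a fib hfib K hK V r hr hV
  obtain ⟨F, hF, hFeq⟩ := exists_resolvent_coefficients D hDn c R fun χ ζ hχ hζ => by
    obtain ⟨N, hN⟩ := hN ζ hζ
    -- With `U` the diagonal operator `χ (a i)`, one has `∑ χ g • D g = U V U⁻¹`, so the hypothesis
    -- at the trivial character carries over to every `χ`.
    obtain ⟨U, hU, -⟩ := exists_diagonal_operator (fun i => χ (a i)) fun i => (hχ _).le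
    obtain ⟨U', hU', -⟩ := exists_diagonal_operator (fun i => χ (-a i)) fun i => (hχ _).le
    have hUU : U * U' = 1 := by
      ext x i
      change U (U' x) i = x i
      rw [hU, hU', ← mul_assoc, ← χ.map_add_eq_mul, add_neg_cancel, χ.map_zero_eq_one, one_mul]
    have hUD : ∀ g, χ g • D g * U = U * D g := fun g => by
      ext x i
      change χ g * D g (U x) i = U (D g x) i
      rw [hU, hD, hD, Finset.mul_sum, Finset.mul_sum]
      refine Finset.sum_congr rfl fun j hj => ?_
      rw [hU, (hfib _ _).1 hj]
      have : χ (a i) = χ g * χ (a i - g) := by rw [← χ.map_add_eq_mul, add_sub_cancel]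
      rw [this]
      ring
    have hs : Summable fun g => χ g • D g :=
      Summable.of_norm_bounded hDn fun g => (norm_smul_le (χ g) (D g)).trans_eq (by rw [hχ g, one_mul])
    have hUV : (∑' g, χ g • D g) * U = U * V := by
      refine (hs.hasSum.mul_right U).unique ?_
      simp only [hUD]
      exact hDV.mul_left U
    refine ⟨U * N * U', ?_⟩
    rw [← mul_assoc, ← mul_assoc, sub_mul, hUV, add_mul, smul_mul_assoc, smul_mul_assoc, one_mul]
    have : c • U + (R * ζ) • U - U * V = U * (c • 1 + (R * ζ) • 1 - V) := by
      rw [mul_sub, mul_add, mul_smul_comm, mul_smul_comm, mul_one]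
    rw [this, mul_assoc, mul_assoc, ← mul_assoc _ N, hN, one_mul, hUU]
  refine ⟨fun p => ‖F p‖, hF, fun j => ?_⟩
  -- `Q h` projects onto the coordinates in the fibre over `h`.
  choose Q hQ hQn using fun h => exists_diagonal_operator (fun i : I => if a i = h then (1 : ℂ) else 0)
    fun i => by split_ifs <;> simp
  have hQD : ∀ h g x, Q h (D g x) = D g (Q (h - g) x) := fun h g x => by
    ext i
    rw [hQ, hD, hD, Finset.mul_sum]
    refine Finset.sum_congr rfl fun k hk => ?_
    rw [hQ, (hfib _ _).1 hk, sub_left_inj]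
    ring
  have he : ∀ i, ‖(lp.single (E := fun _ : I => ℂ) 2 i 1 : L2 I)‖ = 1 := fun i => by
    rw [lp.norm_single (by norm_num), norm_one]
  have hQe : Q (a j) (lp.single 2 j 1) = lp.single 2 j 1 := by
    ext i
    rw [hQ, lp.single_apply, Pi.single_apply]
    by_cases hij : i = j <;> simp [hij]
  set ej : L2 I := lp.single 2 j 1 with hej
  -- `F (h, n)` is not known to be homogeneous of degree `h`, so the right component is cut out by
  -- `Q`; `hQD` shows that the recursion survives.
  let z : G → ℤ → L2 I := fun h n => Q (h + a j) (F (h, n) ej)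
  have hFe : ∀ p, ‖F p ej‖ ≤ ‖F p‖ := fun p =>
    ((F p).le_opNorm _).trans_eq (by rw [hej, he, mul_one])
  have hz : ∀ h n, ‖z h n‖ ≤ ‖F (h, n)‖ := fun h n =>
    ((Q _).le_opNorm _).trans <|
      (mul_le_of_le_one_left (norm_nonneg _) (hQn _)).trans (hFe _)
  have hinj : ∀ n : ℤ, Function.Injective fun g : G => (g, n) := fun n g h hgh =>
    (Prod.ext_iff.1 hgh).1
  have hFs : ∀ n, Summable fun h => ‖F (h, n)‖ := fun n => hF.comp_injective (hinj n)
  have hzn : ∀ n, Summable fun h => ‖z h n‖ := fun n =>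
    Summable.of_nonneg_of_le (fun _ => norm_nonneg _) (fun h => hz h n) (hFs n)
  have hzs : ∀ n, HasSum (fun h => z h n) (∑' h, z h n) := fun n => (hzn n).of_norm.hasSum
  refine ⟨fun n => ∑' h, z h n, ⟨∑' p, ‖F p‖, fun n => ?_⟩, fun n => ?_, fun n i => ?_⟩
  · refine (norm_tsum_le_tsum_norm (hzn n)).trans ?_
    refine ((hzn n).tsum_le_tsum (fun h => hz h n) (hFs n)).trans ?_
    exact tsum_comp_le_tsum_of_inj hF (fun _ => norm_nonneg _) (hinj n)
  · have hrec : ∀ h, HasSum (fun g => D g (z (h - g) n))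
        (c • z h n + R • z h (n - 1) - if h = 0 then (if n = 0 then ej else 0) else 0) := fun h => by
      have h1 := ((hFeq h n).mapL (ContinuousLinearMap.apply ℂ (L2 I) ej)).mapL (Q (h + a j))
      convert h1 using 1
      · ext1 g
        change _ = Q (h + a j) (D g (F (h - g, n) ej))
        rw [hQD, add_sub_right_comm]
      · simp only [map_sub, map_add, map_smul, ContinuousLinearMap.apply_apply]
        congr 1
        by_cases hh : h = 0
        · by_cases hn : n = 0
          · simp [hh, hn, hQe]
          · simp [hn]
        · simp [hh]
    have hPs : Summable fun p : G × G => D p.1 (z p.2 n) := by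
      have h1 := Summable.mul_of_nonneg hDn (hzn n) (fun _ => norm_nonneg _) fun _ => norm_nonneg _
      exact Summable.of_norm_bounded h1 fun p => (D p.1).le_opNorm _
    have hP : HasSum (fun p : G × G => D p.1 (z p.2 n)) (V (∑' h, z h n)) := by
      have h1 := hPs.hasSum.prod_fiberwise fun g => (hzs n).mapL (D g)
      have h2 := hDV.mapL (ContinuousLinearMap.apply ℂ (L2 I) (∑' h, z h n))
      have h3 := h1.unique h2
      rw [ContinuousLinearMap.apply_apply] at h3
      rw [← h3]
      exact hPs.hasSum
    -- Summing the recursion over `h` rearranges the double series along `(h, g) ↦ (g, h - g)`.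
    let e : G × G ≃ G × G :=
      { toFun := fun p => (p.2, p.1 - p.2)
        invFun := fun p => (p.2 + p.1, p.1)
        left_inv := fun p => by simp
        right_inv := fun p => by simp }
    have h4 := ((e.hasSum_iff).2 hP).prod_fiberwise hrec
    have h5 := (((hzs n).const_smul c).add ((hzs (n - 1)).const_smul R)).sub
      (hasSum_ite_eq (0 : G) (if n = 0 then ej else 0))
    rw [h4.unique h5, sub_sub_cancel]
  · have h1 := (hzs n).mapL (lp.evalCLM ℂ (fun _ : I => ℂ) 2 i)
    have h2 : ∀ h, lp.evalCLM ℂ (fun _ : I => ℂ) 2 i (z h n) =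
        if h = a i - a j then F (a i - a j, n) ej i else 0 := fun h => by
      change Q (h + a j) (F (h, n) ej) i = _
      rw [hQ]
      by_cases hh : h = a i - a j
      · simp [hh]
      · have : a i ≠ h + a j := fun h' => hh (by rw [h', add_sub_cancel_right])
        simp [hh, this]
    simp only [h2] at h1
    have h3 := h1.unique (hasSum_ite_eq _ _)
    change ‖lp.evalCLM ℂ (fun _ : I => ℂ) 2 i (∑' h, z h n)‖ ≤ _
    rw [h3]
    exact (lp.norm_apply_le_norm (by norm_num) _ i).trans (hFe _)

end Columns

/-! ### Bounded multiplicity from finite upper density. -/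

section Multiplicity

variable {d e : ℕ} {α : Fin d → ℝ} {n : Fin e → ℕ}

theorem box_encard (N : ℕ) (j : RefGroup α n) : (box N j).encard = (box N (0 : RefGroup α n)).encard := by
  have : box N j = (fun k => k + j) '' box N (0 : RefGroup α n) := by
    ext k
    simp only [box, Set.mem_image, Set.mem_ofPred_eq, sub_zero]
    exact ⟨fun h => ⟨k - j, h, sub_add_cancel _ _⟩, by rintro ⟨l, hl, rfl⟩; simpa using hl⟩
  rw [this]
  exact (add_left_injective j).encard_image _

theorem self_mem_box (N : ℕ) (j : RefGroup α n) : j ∈ box N j := by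
  have : size (j - j) = 0 := by simp [size]
  simp only [box, Set.mem_ofPred_eq, this]
  positivity

/-- A map of finite upper density has fibres of bounded cardinality. -/
theorem exists_fiber_card_le (hn : ∀ j, 0 < n j) {I : Type*} (a : I → RefGroup α n)
    (hD : upperDensity a < ⊤) :
    ∃ (fib : RefGroup α n → Finset I) (K : ℕ), (∀ g i, i ∈ fib g ↔ a i = g) ∧
      ∀ g, (fib g).card ≤ K := by
  obtain ⟨N, hN⟩ := (Filter.eventually_lt_of_limsup_lt hD).exists
  set C : ℝ≥0∞ := ⨆ j : RefGroup α n,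
    ((a ⁻¹' box N j).encard : ℝ≥0∞) / ((box N j).encard : ℝ≥0∞) with hC
  set M : ℝ≥0∞ := ((box N (0 : RefGroup α n)).encard : ℝ≥0∞) with hM
  have hfin := box_finite hn N (0 : RefGroup α n)
  have hMtop : M ≠ ⊤ := by
    rw [hM, ← hfin.cast_ncard_eq]
    simp
  have hM0 : M ≠ 0 := by
    rw [hM, ← hfin.cast_ncard_eq]
    have h0 : (box N (0 : RefGroup α n)) ≠ ∅ := Set.nonempty_iff_ne_empty.1 ⟨0, self_mem_box N 0⟩
    simpa [hfin] using h0
  -- The fibre over `g` lies in the preimage of the box about `g`, and all boxes of size `N` have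
  -- the same finite nonzero cardinality `M`.
  have hle : ∀ g, ((a ⁻¹' {g}).encard : ℝ≥0∞) ≤ C * M := fun g => by
    have h1 : ((a ⁻¹' box N g).encard : ℝ≥0∞) / M ≤ C := by
      rw [hM, ← box_encard N g]
      exact le_iSup (fun j : RefGroup α n =>
        ((a ⁻¹' box N j).encard : ℝ≥0∞) / ((box N j).encard : ℝ≥0∞)) g
    rw [ENNReal.div_le_iff hM0 hMtop] at h1
    refine le_trans ?_ h1
    have h2 : (a ⁻¹' {g}).encard ≤ (a ⁻¹' box N g).encard :=
      Set.encard_le_encard (Set.preimage_mono (Set.singleton_subset_iff.2 (self_mem_box N g)))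
    exact_mod_cast h2
  have htop : C * M < ⊤ := ENNReal.mul_lt_top hN hMtop.lt_top
  have hfib : ∀ g, (a ⁻¹' {g}).Finite := fun g => by
    rw [← Set.encard_lt_top_iff]
    have := (hle g).trans_lt htop
    exact_mod_cast this
  obtain ⟨K, hK⟩ := ENNReal.exists_nat_gt htop.ne
  refine ⟨fun g => (hfib g).toFinset, K, fun g i => by simp, fun g => ?_⟩
  have h1 := (hle g).trans hK.le
  rw [(hfib g).encard_eq_coe_toFinset_card] at h1
  exact_mod_cast h1

end Multiplicity

/-- Iterating gives `‖v k‖ ≤ q ^ m * C` for every `m`. This singles out the bounded solution of the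
recursion. -/
theorem eq_zero_of_norm_le_mul_succ {E : Type*} [NormedAddCommGroup E] {v : ℕ → E} {q C : ℝ}
    (hq0 : 0 ≤ q) (hq1 : q < 1) (hv : ∀ k, ‖v k‖ ≤ q * ‖v (k + 1)‖) (hC : ∀ k, ‖v k‖ ≤ C) (k : ℕ) :
    v k = 0 := by
  have h1 : ∀ m, ‖v k‖ ≤ q ^ m * C := fun m => by
    have : ‖v k‖ ≤ q ^ m * ‖v (k + m)‖ := by
      induction m with
      | zero => simp
      | succ m ih =>
        refine ih.trans ?_
        rw [pow_succ, mul_assoc]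
        exact mul_le_mul_of_nonneg_left (hv _) (by positivity)
    exact this.trans (mul_le_mul_of_nonneg_left (hC _) (by positivity))
  have h2 := (tendsto_pow_atTop_nhds_zero_of_lt_one hq0 hq1).mul_const C
  rw [zero_mul] at h2
  exact norm_le_zero_iff.1 (ge_of_tendsto' h2 h1)

/-! ### Spectral estimates for the frame operator. -/

section FrameOperator

variable {H : Type*} [NormedAddCommGroup H] [InnerProductSpace ℂ H] {I : Type*}
  (f : I → H) (hf : IsFrame f)

theorem analysis_apply (x : H) (i : I) : analysis f hf x i = inner ℂ (f i) x := rfl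

variable [CompleteSpace H]

theorem adjoint_analysis_single [DecidableEq I] (j : I) :
    ContinuousLinearMap.adjoint (analysis f hf) (lp.single 2 j 1) = f j := by
  refine ext_inner_right ℂ fun x => ?_
  rw [ContinuousLinearMap.adjoint_inner_left, lp.inner_single_left, analysis_apply]
  simp

theorem inner_frameOperator_self (x : H) :
    inner ℂ (frameOperator f hf x) x = ((∑' i, ‖inner ℂ (f i) x‖ ^ 2 : ℝ) : ℂ) := by
  rw [frameOperator, ContinuousLinearMap.comp_apply, ContinuousLinearMap.adjoint_inner_left,
    inner_self_eq_norm_sq_to_K, ← hf.norm_sq x]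
  norm_cast

theorem frameOperator_nonneg : 0 ≤ frameOperator f hf :=
  ContinuousLinearMap.nonneg_iff_isPositive _ |>.2
    (ContinuousLinearMap.isPositive_adjoint_comp_self _)

/-- The frame bounds give `0 ≤ (A + B) - S ≤ B`. Centring at `A + B` rather than at the midpoint
avoids the need for `A ≤ B`, which can fail when `H` is zero. -/
theorem norm_smul_one_sub_frameOperator_le {A B : ℝ} (hB : 0 < B)
    (h : ∀ x, A * ‖x‖ ^ 2 ≤ ∑' i, ‖inner ℂ (f i) x‖ ^ 2 ∧
      ∑' i, ‖inner ℂ (f i) x‖ ^ 2 ≤ B * ‖x‖ ^ 2) (hA : 0 ≤ A) :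
    ‖frameOperator f hf - ((A + B : ℝ) : ℂ) • (1 : H →L[ℂ] H)‖ ≤ B := by
  rw [← norm_neg, neg_sub]
  have hsa : IsSelfAdjoint (frameOperator f hf) := (frameOperator_nonneg f hf).isSelfAdjoint
  have hreal : ∀ t : ℝ, IsSelfAdjoint ((t : ℂ) • (1 : H →L[ℂ] H)) := fun t =>
    IsSelfAdjoint.smul (by simp [IsSelfAdjoint]) (IsSelfAdjoint.one _)
  have hre : ∀ x, RCLike.re (inner ℂ (frameOperator f hf x) x) = ∑' i, ‖inner ℂ (f i) x‖ ^ 2 :=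
    fun x => by rw [inner_frameOperator_self]; exact Complex.ofReal_re _
  have hre' : ∀ (t : ℝ) x, RCLike.re (inner ℂ ((t : ℂ) • x : H) x) = t * ‖x‖ ^ 2 := fun t x => by
    rw [inner_smul_left, inner_self_eq_norm_sq_to_K]
    simp only [Complex.conj_ofReal, Complex.coe_algebraMap]
    rw [← Complex.ofReal_pow, ← Complex.ofReal_mul]
    exact Complex.ofReal_re _
  have h0 : 0 ≤ ((A + B : ℝ) : ℂ) • (1 : H →L[ℂ] H) - frameOperator f hf := by
    rw [ContinuousLinearMap.nonneg_iff_isPositive, ContinuousLinearMap.isPositive_def]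
    refine ⟨((hreal _).sub hsa).isSymmetric, fun x => ?_⟩
    change 0 ≤ RCLike.re (inner ℂ (((A + B : ℝ) : ℂ) • x - frameOperator f hf x) x)
    rw [inner_sub_left, map_sub, hre, hre']
    nlinarith [(h x).2, sq_nonneg ‖x‖]
  rw [CStarAlgebra.norm_le_iff_le_algebraMap _ hB.le h0, ← sub_nonneg,
    ContinuousLinearMap.nonneg_iff_isPositive, ContinuousLinearMap.isPositive_def]
  have : algebraMap ℝ (H →L[ℂ] H) B - (((A + B : ℝ) : ℂ) • (1 : H →L[ℂ] H) - frameOperator f hf) =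
      frameOperator f hf - (A : ℂ) • (1 : H →L[ℂ] H) := by
    ext x
    change B • x - (((A + B : ℝ) : ℂ) • x - frameOperator f hf x) = frameOperator f hf x - (A : ℂ) • x
    rw [← Complex.coe_smul B]
    push_cast
    rw [add_smul]
    abel
  rw [this]
  refine ⟨(hsa.sub (hreal _)).isSymmetric, fun x => ?_⟩
  change 0 ≤ RCLike.re (inner ℂ (frameOperator f hf x - (A : ℂ) • x) x)
  rw [inner_sub_left, map_sub, hre, hre']
  linarith [(h x).1]

/-- A nonzero number outside the spectrum of `T* T` is outside the spectrum of `T T*`. -/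
theorem exists_sub_comp_adjoint_mul_eq_one {E F : Type*} [NormedAddCommGroup E]
    [InnerProductSpace ℂ E] [CompleteSpace E] [NormedAddCommGroup F] [InnerProductSpace ℂ F]
    [CompleteSpace F] (T : E →L[ℂ] F) (w : ℂ) (hw : w ≠ 0)
    (h : IsUnit (w • (1 : E →L[ℂ] E) - (ContinuousLinearMap.adjoint T).comp T)) :
    ∃ N : F →L[ℂ] F, (w • (1 : F →L[ℂ] F) - T.comp (ContinuousLinearMap.adjoint T)) * N = 1 := by
  obtain ⟨M, hM⟩ := h.exists_right_inv
  -- The identity `(w - TT*)⁻¹ = w⁻¹ (1 + T (w - T*T)⁻¹ T*)`.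
  refine ⟨w⁻¹ • (1 + (T.comp M).comp (ContinuousLinearMap.adjoint T)), ?_⟩
  ext1 x
  have h1 := DFunLike.congr_fun hM (ContinuousLinearMap.adjoint T x)
  simp only [mul_apply_eq_comp, sub_apply, smul_apply, one_apply_eq_self,
    ContinuousLinearMap.comp_apply, add_apply, map_smul, map_add] at h1 ⊢
  have h2 := congrArg T h1
  rw [map_sub, map_smul, sub_eq_iff_eq_add] at h2
  rw [h2, add_sub_cancel_right, sub_add_cancel, smul_smul, inv_mul_cancel₀ hw, one_smul]

end FrameOperator

/-! ### Riesz projection and pseudoinverse from a bounded solution of the recursion. -/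

section Recursion

variable {E F : Type*} [NormedAddCommGroup E] [NormedSpace ℂ E] [NormedAddCommGroup F]
  [NormedSpace ℂ F]

/-- The bounded solutions of the recursion satisfied by the Fourier coefficients of the resolvent
of a product of two operators, on a circle around the spectrum of the reversed product `S`. -/
theorem pseudoinverse_of_recursion [CompleteSpace E] (T : E →L[ℂ] F) (T' : F →L[ℂ] E)
    (S Si : E →L[ℂ] E)
    (hS : ∀ x, T' (T x) = S x) (hSi : ∀ x, Si (S x) = x) {B R c C : ℝ} (hB : 0 ≤ B)
    (hBR : B < R) (hRc : R < c) (hE : ‖S - (c : ℂ) • (1 : E →L[ℂ] E)‖ ≤ B) (y : ℤ → F)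
    (hC : ∀ n, ‖y n‖ ≤ C) (e : F)
    (hrec : ∀ n, (c : ℂ) • y n + (R : ℂ) • y (n - 1) - T (T' (y n)) = if n = 0 then e else 0) :
    (R : ℂ) • y (-1) = T (Si (T' e)) ∧
      HasSum (fun k : ℕ => ((R / c : ℂ) * (-(R / c : ℂ)) ^ k) • y (-1 - k))
        (T (Si (Si (T' e)))) := by
  have hR : 0 < R := hB.trans_lt hBR
  have hc : 0 < c := hR.trans hRc
  have hc' : (c : ℂ) ≠ 0 := by exact_mod_cast hc.ne'
  have hx : ∀ n, (c : ℂ) • T' (y n) + (R : ℂ) • T' (y (n - 1)) - S (T' (y n)) =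
      if n = 0 then T' e else 0 := fun n => by
    have := congrArg T' (hrec n)
    rw [map_sub, map_add, map_smul, map_smul, hS] at this
    rw [this]
    split_ifs
    · rfl
    · exact map_zero T'
  have hxC : ∀ n, ‖T' (y n)‖ ≤ ‖T'‖ * C := fun n =>
    (T'.le_opNorm _).trans (mul_le_mul_of_nonneg_left (hC n) (norm_nonneg _))
  -- For `n ≥ 1` the recursion reads `R x (n - 1) = (S - c) x n` with `x = T' y`. Since `‖S - c‖ ≤ B
  -- < R`, boundedness forces `x n = 0` for `n ≥ 0`.
  have hx0 : T' (y 0) = 0 := by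
    have := eq_zero_of_norm_le_mul_succ (v := fun k : ℕ => T' (y k)) (q := B / R)
      (by positivity) ((div_lt_one hR).2 hBR) (fun k => ?_) (fun k => hxC k) 0
    · simpa using this
    · have h1 := hx (k + 1)
      rw [add_sub_cancel_right, if_neg (by omega)] at h1
      have h2 : (R : ℂ) • T' (y k) = (S - (c : ℂ) • (1 : E →L[ℂ] E)) (T' (y (k + 1))) := by
        change _ = S (T' (y (k + 1))) - (c : ℂ) • T' (y (k + 1))
        rw [eq_sub_iff_add_eq', ← sub_eq_zero, h1]
      have h3 : R * ‖T' (y k)‖ ≤ B * ‖T' (y (k + 1))‖ := by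
        have h4 : ‖(R : ℂ) • T' (y k)‖ = R * ‖T' (y k)‖ := by
          rw [norm_smul, Complex.norm_real, Real.norm_of_nonneg hR.le]
        rw [← h4, h2]
        exact (ContinuousLinearMap.le_opNorm _ _).trans
          (mul_le_mul_of_nonneg_right hE (norm_nonneg _))
      push_cast
      rw [div_mul_eq_mul_div, le_div_iff₀ hR]
      linarith
  have hx1 : (R : ℂ) • T' (y (-1)) = T' e := by
    have := hx 0
    rw [hx0] at this
    simpa using this
  -- `T Si T'` is a projection, and for negative `n` the complementary part `w n` of `y n` satisfies
  -- `c w n = -R w (n - 1)`. As `R < c`, boundedness makes it vanish.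
  have hyx : ∀ k : ℕ, y (-1 - k) = T (Si (T' (y (-1 - k)))) := fun k => by
    have := eq_zero_of_norm_le_mul_succ
      (v := fun k : ℕ => y (-1 - k) - T (Si (T' (y (-1 - k))))) (q := R / c)
      (C := C + ‖T‖ * (‖Si‖ * (‖T'‖ * C)))
      (by positivity) ((div_lt_one hc).2 hRc) (fun k => ?_) (fun k => ?_) k
    · exact sub_eq_zero.1 this
    · have h1 := hrec (-1 - k)
      rw [if_neg (by omega)] at h1
      have h2 := congrArg (fun z => T (Si z)) (hx (-1 - k))
      simp only [if_neg (show ¬ (-1 - (k : ℤ) = 0) by omega), map_sub, map_add, map_smul, hSi,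
        map_zero] at h2
      have h3 : (c : ℂ) • (y (-1 - k) - T (Si (T' (y (-1 - k))))) =
          -((R : ℂ) • (y (-1 - k - 1) - T (Si (T' (y (-1 - k - 1)))))) := by
        rw [smul_sub, smul_sub, ← sub_eq_zero, ← sub_eq_zero.2 (h1.trans h2.symm)]
        abel
      have h4 := congrArg norm h3
      rw [norm_neg, norm_smul, norm_smul, Complex.norm_real, Complex.norm_real,
        Real.norm_of_nonneg hR.le, Real.norm_of_nonneg hc.le] at h4
      have h5 : -1 - ((k + 1 : ℕ) : ℤ) = -1 - k - 1 := by push_cast; ring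
      simp only [h5]
      rw [div_mul_eq_mul_div, le_div_iff₀ hc]
      linarith
    · refine (norm_sub_le _ _).trans (add_le_add (hC _) ?_)
      refine (T.le_opNorm _).trans (mul_le_mul_of_nonneg_left ?_ (norm_nonneg _))
      exact (Si.le_opNorm _).trans (mul_le_mul_of_nonneg_left (hxC _) (norm_nonneg _))
  refine ⟨?_, ?_⟩
  · have h1 := hyx 0
    simp only [Nat.cast_zero, sub_zero] at h1
    rw [h1, ← map_smul, ← map_smul, hx1]
  · have hq : ‖-(R / c : ℂ)‖ = R / c := by
      rw [norm_neg, norm_div, Complex.norm_real, Complex.norm_real, Real.norm_of_nonneg hR.le,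
        Real.norm_of_nonneg hc.le]
    have ht : Summable fun k : ℕ => (-(R / c : ℂ)) ^ k • T' (y (-1 - k)) := by
      refine Summable.of_norm_bounded ((summable_geometric_of_lt_one (r := R / c) (by positivity)
        ((div_lt_one hc).2 hRc)).mul_right (‖T'‖ * C)) fun k => ?_
      rw [norm_smul, norm_pow, hq]
      exact mul_le_mul_of_nonneg_left (hxC _) (by positivity)
    have hu := ht.hasSum.const_smul (R / c : ℂ)
    simp only [smul_smul] at hu
    set u := (R / c : ℂ) • ∑' k : ℕ, (-(R / c : ℂ)) ^ k • T' (y (-1 - k)) with hudef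
    -- Expanding `1 / (c + Rζ)` geometrically in `ζ` gives the weights; the recursion makes `S u`
    -- telescope to `R x (-1) = T' e`.
    have hSu : S u = T' e := by
      have h1 : ∀ k : ℕ, S (((R / c : ℂ) * (-(R / c : ℂ)) ^ k) • T' (y (-1 - k))) =
          (R : ℂ) • ((-(R / c : ℂ)) ^ k • T' (y (-1 - k)) -
            (-(R / c : ℂ)) ^ (k + 1) • T' (y (-1 - (k + 1 : ℕ)))) := fun k => by
        have h2 := hx (-1 - k)
        rw [if_neg (by omega), sub_eq_zero] at h2
        have h5 : -1 - ((k + 1 : ℕ) : ℤ) = -1 - k - 1 := by push_cast; ring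
        have h6 : (R / c * (-(R / c)) ^ k * c : ℂ) = R * (-(R / c)) ^ k := by field_simp
        have h7 : (R / c * (-(R / c)) ^ k * R : ℂ) = -(R * (-(R / c)) ^ (k + 1)) := by
          rw [pow_succ]
          ring
        rw [map_smul, ← h2, h5, smul_sub, smul_add, smul_smul, smul_smul, smul_smul, smul_smul,
          h6, h7, neg_smul, ← sub_eq_add_neg]
      have h3 := hu.mapL S
      simp only [h1] at h3
      have h4 := (ht.hasSum.sub ((summable_nat_add_iff 1).2 ht).hasSum).const_smul (R : ℂ)
      rw [h3.unique h4, ht.tsum_eq_zero_add, add_sub_cancel_right]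
      simpa using hx1
    have h6 : Si (T' e) = u := by rw [← hSu, hSi]
    have h7 := (hu.mapL Si).mapL T
    rw [h6]
    convert h7 using 2 with k
    rw [map_smul, map_smul, ← hyx]

end Recursion

/-! ### Decay of the inverse frame operator and its consequences. -/

section Main

variable {H : Type*} [NormedAddCommGroup H] [InnerProductSpace ℂ H] [CompleteSpace H] {I : Type*}
  {G : Type*} [AddCommGroup G]

/-- The matrices of the first two powers of the inverse frame operator are dominated by summable
functions. -/
theorem exists_summable_bound_inverse (a : I → G) (fib : G → Finset I)
    (hfib : ∀ g i, i ∈ fib g ↔ a i = g) (K : ℕ) (hK : ∀ g, (fib g).card ≤ K) (f : I → H)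
    (hf : IsFrame f) (hloc : IsSelfLocalized 1 f a) :
    (∃ r : G → ℝ, Summable r ∧
      ∀ i j, ‖inner ℂ (f i) (Ring.inverse (frameOperator f hf) (f j))‖ ≤ r (a i - a j)) ∧
    ∃ r : G → ℝ, Summable r ∧ ∀ i j, ‖inner ℂ (f i) (Ring.inverse (frameOperator f hf)
      (Ring.inverse (frameOperator f hf) (f j)))‖ ≤ r (a i - a j) := by
  classical
  obtain ⟨r, hr⟩ := hloc
  have hf' := hf
  obtain ⟨A, B, hA, hB, hAB⟩ := hf'
  set T := analysis f hf with hT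
  set S := frameOperator f hf with hS
  set Si := Ring.inverse S with hSi
  have hSiS : ∀ x, Si (S x) = x := fun x =>
    DFunLike.congr_fun (Ring.inverse_mul_cancel S (isUnit_frameOperator f hf)) x
  -- Midway between `B`, the bound on `‖S - (A + B)‖`, and `A + B`, the distance from the centre to
  -- `0`.
  set R : ℝ := B + A / 2 with hRdef
  have hE : ‖S - ((A + B : ℝ) : ℂ) • (1 : H →L[ℂ] H)‖ ≤ B :=
    norm_smul_one_sub_frameOperator_le f hf hB (fun x => (hAB x).2) hA.le
  have hR : 0 < R := by positivity
  have hBR : B < R := by linarith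
  have hRc : R < A + B := by linarith
  have hTa : ∀ j, ContinuousLinearMap.adjoint T (lp.single 2 j 1) = f j :=
    adjoint_analysis_single f hf
  obtain ⟨s, hs, hcol⟩ := exists_localized_columns a fib hfib K hK
    (T.comp (ContinuousLinearMap.adjoint T)) r (lp_one_summable r)
    (fun i j => by
      rw [ContinuousLinearMap.comp_apply, hTa]
      exact hr i j)
    ((A + B : ℝ) : ℂ) (R : ℂ) (fun ζ hζ => by
      have hw : ((A + B : ℝ) : ℂ) + R * ζ ≠ 0 := fun h0 => by
        have h1 := congrArg norm (eq_neg_of_add_eq_zero_left h0)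
        rw [norm_neg, norm_mul, hζ, mul_one, Complex.norm_real, Complex.norm_real,
          Real.norm_of_nonneg hR.le, Real.norm_of_nonneg (by positivity)] at h1
        linarith
      obtain ⟨N, hN⟩ := exists_sub_comp_adjoint_mul_eq_one T _ hw (by
        have h1 : R * ζ ∈ resolventSet ℂ (S - ((A + B : ℝ) : ℂ) • (1 : H →L[ℂ] H)) := by
          refine spectrum.mem_resolventSet_of_norm_lt_mul ?_
          rw [norm_mul, hζ, mul_one, Complex.norm_real, Real.norm_of_nonneg hR.le]
          refine lt_of_le_of_lt ?_ hBR
          exact (mul_le_of_le_one_right (norm_nonneg _) ContinuousLinearMap.norm_id_le).trans hE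
        have h2 := spectrum.mem_resolventSet_iff.1 h1
        convert h2 using 1
        rw [Algebra.algebraMap_eq_smul_one, add_smul, sub_sub_eq_add_sub, add_comm]
        rfl)
      exact ⟨N, by rw [← add_smul, hN]⟩)
  have hid : ∀ j, ∃ y : ℤ → L2 I, (R : ℂ) • y (-1) = T (Si (f j)) ∧
      HasSum (fun k : ℕ => ((R / (A + B : ℝ) : ℂ) * (-(R / (A + B : ℝ) : ℂ)) ^ k) • y (-1 - k))
        (T (Si (Si (f j)))) ∧ ∀ n i, ‖y n i‖ ≤ s (a i - a j, n) := fun j => by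
    obtain ⟨y, ⟨C, hC⟩, hrec, hys⟩ := hcol j
    obtain ⟨h1, h2⟩ := pseudoinverse_of_recursion T (ContinuousLinearMap.adjoint T) S Si
      (fun x => rfl) hSiS hB.le hBR hRc hE y hC (lp.single 2 j 1) hrec
    rw [hTa] at h1 h2
    exact ⟨y, h1, h2, hys⟩
  have hq : ‖(R / (A + B : ℝ) : ℂ)‖ ≤ 1 := by
    rw [norm_div, Complex.norm_real, Complex.norm_real, Real.norm_of_nonneg hR.le,
      Real.norm_of_nonneg (by positivity), div_le_one (by positivity)]
    exact hRc.le
  have hinj : ∀ n : ℤ, Function.Injective fun g : G => (g, n) := fun n g h hgh =>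
    (Prod.ext_iff.1 hgh).1
  have hinj2 : Function.Injective fun p : G × ℕ => (p.1, -1 - (p.2 : ℤ)) := by
    rintro ⟨g, k⟩ ⟨g', k'⟩ h
    simp only [Prod.mk.injEq] at h ⊢
    exact ⟨h.1, by omega⟩
  have hs2 : Summable fun p : G × ℕ => s (p.1, -1 - (p.2 : ℤ)) := hs.comp_injective hinj2
  -- The first matrix uses only the coefficient at `-1`; the second uses all negative frequencies,
  -- with weights of modulus at most `1`.
  refine ⟨⟨fun g => R * s (g, -1), (hs.comp_injective (hinj (-1))).mul_left R, fun i j => ?_⟩,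
    ⟨fun g => ∑' k : ℕ, s (g, -1 - (k : ℤ)), hs2.prod, fun i j => ?_⟩⟩
  · obtain ⟨y, h1, -, h3⟩ := hid j
    have h4 : inner ℂ (f i) (Si (f j)) = (R : ℂ) * y (-1) i :=
      (congrArg (fun z : L2 I => z i) h1).symm
    rw [h4, norm_mul, Complex.norm_real, Real.norm_of_nonneg hR.le]
    exact mul_le_mul_of_nonneg_left (h3 _ _) hR.le
  · obtain ⟨y, -, h2, h3⟩ := hid j
    have h4 := h2.mapL (lp.evalCLM ℂ (fun _ : I => ℂ) 2 i)
    have h5 : inner ℂ (f i) (Si (Si (f j))) = _ := h4.tsum_eq.symm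
    have h6 : Summable fun k : ℕ => s (a i - a j, -1 - (k : ℤ)) :=
      hs2.prod_factor (a i - a j)
    rw [h5]
    refine tsum_of_norm_bounded h6.hasSum fun k => ?_
    rw [map_smul, norm_smul, norm_mul, norm_pow, norm_neg]
    refine (mul_le_of_le_one_left (norm_nonneg _) ?_).trans (h3 _ _)
    exact mul_le_one₀ hq (by positivity) (pow_le_one₀ (norm_nonneg _) hq)

/-- A matrix dominated by a summable function is dominated by an element of `ℓ¹`. -/
theorem exists_lp_one_bound {M : I → I → ℂ} {a : I → G}
    (h : ∃ r : G → ℝ, Summable r ∧ ∀ i j, ‖M i j‖ ≤ r (a i - a j)) :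
    ∃ r : lp (fun _ : G => ℝ) 1, ∀ i j, ‖M i j‖ ≤ r (a i - a j) := by
  obtain ⟨r, hr, hM⟩ := h
  exact ⟨⟨r, memℓp_one_iff.2 hr.norm⟩, hM⟩

theorem inner_inverse_frameOperator (f : I → H) (hf : IsFrame f) (x z : H) :
    inner ℂ (Ring.inverse (frameOperator f hf) x) z =
      inner ℂ x (Ring.inverse (frameOperator f hf) z) := by
  have hsa := (frameOperator_nonneg f hf).isSelfAdjoint.isSymmetric
  have h1 : ∀ w, frameOperator f hf (Ring.inverse (frameOperator f hf) w) = w := fun w =>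
    DFunLike.congr_fun (Ring.mul_inverse_cancel _ (isUnit_frameOperator f hf)) w
  have h2 := hsa (Ring.inverse (frameOperator f hf) x) (Ring.inverse (frameOperator f hf) z)
  simp only [ContinuousLinearMap.coe_coe, h1] at h2
  exact h2.symm

/-- `S^{-1/2}` is self-adjoint with square `S⁻¹`, so the Gram matrix of the Parseval frame is the
cross-Gram matrix of the frame with its dual. -/
theorem inner_canonicalParseval (f : I → H) (hf : IsFrame f) (i j : I) :
    inner ℂ (canonicalParseval f hf i) (canonicalParseval f hf j) =
      inner ℂ (f i) (Ring.inverse (frameOperator f hf) (f j)) := by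
  have hu := isUnit_frameOperator f hf
  have hnn := frameOperator_nonneg f hf
  have hsa : IsSelfAdjoint (frameOperator f hf ^ (-(1 / 2) : ℝ) : H →L[ℂ] H) :=
    (CFC.rpow_nonneg).isSelfAdjoint
  have h1 : Ring.inverse (frameOperator f hf) =
      (frameOperator f hf ^ (-(1 / 2) : ℝ) : H →L[ℂ] H) * frameOperator f hf ^ (-(1 / 2) : ℝ) := by
    rw [← CFC.rpow_add hu, CFC.inverse_eq_rpow_neg_one (hu.isStrictlyPositive hnn)]
    norm_num
  rw [h1]
  exact hsa.isSymmetric _ _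

end Main

end LocalizedFrames

end

theorem theorem2p9
    {H : Type*} [NormedAddCommGroup H] [InnerProductSpace ℂ H] [CompleteSpace H]
    [TopologicalSpace.SeparableSpace H]
    {d e : ℕ} (α : Fin d → ℝ) (hα : ∀ i, 0 < α i) (n : Fin e → ℕ) (hn : ∀ j, 0 < n j)
    {I : Type*} [Countable I] (a : I → LocalizedFrames.RefGroup α n)
    (hD : LocalizedFrames.upperDensity a < ⊤)
    (f : I → H) (hf : LocalizedFrames.IsFrame f)
    (hloc : LocalizedFrames.IsSelfLocalized 1 f a) :
    LocalizedFrames.IsDualLocalized 1 f hf a ∧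
    LocalizedFrames.IsSelfLocalized 1 (LocalizedFrames.canonicalDual f hf) a ∧
    LocalizedFrames.IsSelfLocalized 1 (LocalizedFrames.canonicalParseval f hf) a := by
  obtain ⟨fib, K, hfib, hK⟩ := LocalizedFrames.exists_fiber_card_le hn a hD
  obtain ⟨h1, h2⟩ := LocalizedFrames.exists_summable_bound_inverse a fib hfib K hK f hf hloc
  refine ⟨LocalizedFrames.exists_lp_one_bound h1, LocalizedFrames.exists_lp_one_bound ?_,
    LocalizedFrames.exists_lp_one_bound ?_⟩
  -- Self-adjointness of `S⁻¹` turns the Gram matrix of the dual frame into `⟨f i, S⁻² f j⟩`.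
  · simpa only [LocalizedFrames.canonicalDual,
      LocalizedFrames.inner_inverse_frameOperator f hf] using h2
  · simpa only [LocalizedFrames.inner_canonicalParseval f hf] using h1
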